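/- Let finitely many parties $r\in P$ hold quantum systems with Hilbert spaces $\mathbb C^{d_r}$, and let $\rho$ be a density matrix on $\bigotimes_{r}\mathbb C^{d_r}$ (the bipartite case is $|P|=2$). Call $\rho$ separable if it is a finite convex combination of product states $\bigotimes_r\sigma_r$, and entangled otherwise. For a density matrix $\sigma$ on a space of dimension $D$ let $S(\sigma)=-\operatorname{tr}\sigma\log_2\sigma$ and $I(\sigma)=\log_2 D-S(\sigma)$. A CLOCC operation is a finite composition of (i) local unitary transformations $\rho\mapsto(\bigotimes_r U_r)\,\rho\,(\bigotimes_r U_r)^\dagger$, and (ii) sending a subsystem (a tensor factor, possibly all, of one party's system) to another party through a completely dephasing channel, which acts on the sent subsystem as $\rho\mapsto\sum_i P_i\rho P_i$ with $(P_i)$ the rank-one projectors onto an orthonormal basis; the sent factor then belongs to the receiver's system, so that the local dimensions may change while the total dimension does not. A party left with no system has the one-dimensional space $\mathbb C$, with information $0$. The localisable information of $\rho$ is $$I_l(\rho)=\sup_{\Lambda\in\mathrm{CLOCC}}\ \sum_{r} I(\rho'_r),\qquad \rho'=\Lambda(\rho),$$ where $\rho'_r$ is the reduced state of party $r$, and the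 quantum information deficit is $\Delta(\rho)=I(\rho)-I_l(\rho)$. Then every entangled state $\rho$ has strictly positive deficit: $\Delta(\rho)>0$. -/

import Mathlib

open scoped Matrix ComplexOrder

namespace QuantumDeficit

/-- Basis labels of the composite system: the parties are the elements of `P`, and party `r`
holds a system with Hilbert space of dimension `d r`. -/
abbrev Idx {P : Type*} (d : P → ℕ) : Type _ := ∀ r, Fin (d r)

/-- Operators on the Hilbert space of the composite system. -/
abbrev Op {P : Type*} (d : P → ℕ) : Type _ := Matrix (Idx d) (Idx d) ℂ

/-- Density matrices: positive semidefinite with unit trace. -/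
def IsDensity {X : Type*} [Fintype X] (ρ : Matrix X X ℂ) : Prop :=
  ρ.PosSemidef ∧ ρ.trace = 1

/-- The tensor product of local operators, one for each party. -/
def tensor {P : Type*} [Fintype P] {d : P → ℕ}
    (M : ∀ r, Matrix (Fin (d r)) (Fin (d r)) ℂ) : Op d :=
  Matrix.of fun x y => ∏ r, M r (x r) (y r)

/-- (Fully) separable states: finite convex combinations of product states. -/
def IsSeparable {P : Type*} [Fintype P] {d : P → ℕ} (ρ : Op d) : Prop :=
  ρ ∈ convexHull ℝ {τ : Op d | ∃ M : ∀ r, Matrix (Fin (d r)) (Fin (d r)) ℂ,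
    (∀ r, IsDensity (M r)) ∧ τ = tensor M}

/-- Entangled states: states that are not separable. -/
def IsEntangled {P : Type*} [Fintype P] [DecidableEq P] {d : P → ℕ} (ρ : Op d) : Prop :=
  IsDensity ρ ∧ ¬ IsSeparable ρ

open scoped Classical in
/-- The von Neumann entropy `- tr ρ log₂ ρ`, computed from the eigenvalues of `ρ`
(only used for Hermitian `ρ`). -/
noncomputable def entropy {X : Type*} [Fintype X] [DecidableEq X] (ρ : Matrix X X ℂ) : ℝ :=
  if h : ρ.IsHermitian then - ∑ i, h.eigenvalues i * Real.logb 2 (h.eigenvalues i) else 0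

/-- The information function `I(ρ) = log₂ (dimension) - S(ρ)`. -/
noncomputable def information {X : Type*} [Fintype X] [DecidableEq X] (ρ : Matrix X X ℂ) : ℝ :=
  Real.logb 2 (Fintype.card X) - entropy ρ

/-- The reduced state of party `r` (partial trace over all the other parties). -/
def reduced {P : Type*} [Fintype P] [DecidableEq P] {d : P → ℕ} (r : P) (ρ : Op d) :
    Matrix (Fin (d r)) (Fin (d r)) ℂ :=
  Matrix.of fun a b => ∑ x : Idx d, if x r = a then ρ x (Function.update x r b) else 0

/-- Total local information `∑ᵣ I(ρᵣ)`. A party left with nothing has `d r = 1` and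
contributes `0`. -/
noncomputable def localInformation {P : Type*} [Fintype P] [DecidableEq P] {d : P → ℕ}
    (ρ : Op d) : ℝ :=
  ∑ r, information (reduced r ρ)

/-- The action `ρ ↦ (⨂ U) ρ (⨂ U)†` of local unitary operators, one for each party. -/
def localUnitary {P : Type*} [Fintype P] [DecidableEq P] {d : P → ℕ}
    (U : ∀ r, Matrix.unitaryGroup (Fin (d r)) ℂ) (ρ : Op d) : Op d :=
  tensor (fun r => (U r : Matrix (Fin (d r)) (Fin (d r)) ℂ)) * ρ *
    (tensor (fun r => (U r : Matrix (Fin (d r)) (Fin (d r)) ℂ)))ᴴ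

/-- A reallocation of a subsystem from party `sender` to party `receiver`. The local dimensions
change from `d` to `d'`. The system of the sender is split as (remaining part) ⊗ (sent subsystem of
dimension `b`), the receiver's new system is (old system) ⊗ (sent subsystem), and every other party
keeps its system. `relabel` is the induced relabelling of the product basis of the composite
system, which the other data determine. -/
structure Transfer {P : Type*} (d d' : P → ℕ) where
  sender : P
  receiver : P
  ne : sender ≠ receiver
  b : ℕ
  split : Fin (d sender) ≃ Fin (d' sender) × Fin b
  join : Fin (d receiver) × Fin b ≃ Fin (d' receiver)
  keep : ∀ r, r ≠ sender → r ≠ receiver → (Fin (d r) ≃ Fin (d' r))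
  relabel : Idx d ≃ Idx d'
  relabel_sender : ∀ x, relabel x sender = (split (x sender)).1
  relabel_receiver : ∀ x, relabel x receiver = join (x receiver, (split (x sender)).2)
  relabel_other : ∀ x r (h₁ : r ≠ sender) (h₂ : r ≠ receiver), relabel x r = keep r h₁ h₂ (x r)

/-- Sending the subsystem through the completely dephasing channel: `ρ ↦ ∑ᵢ Pᵢ ρ Pᵢ` with `Pᵢ` the
rank one projectors onto the basis vectors of the sent subsystem (the entries between different
basis vectors of that subsystem are erased), after which the subsystem is with the receiver.
Other bases and other tensor factorizations of the sender's space are obtained by composing with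
local unitaries. -/
def Transfer.send {P : Type*} {d d' : P → ℕ} (T : Transfer d d') (ρ : Op d) : Op d' :=
  Matrix.of fun x' y' =>
    let x := T.relabel.symm x'
    let y := T.relabel.symm y'
    if (T.split (x T.sender)).2 = (T.split (y T.sender)).2 then ρ x y else 0

/-- CLOCC operations: all maps composed of local unitaries and of sending subsystems through
completely dephasing channels. -/
inductive IsCLOCC {P : Type*} [Fintype P] [DecidableEq P] (d : P → ℕ) :
    (d' : P → ℕ) → (Op d → Op d') → Prop
  | protected id : IsCLOCC d d (fun ρ => ρ)
  | unitary {d' : P → ℕ} {Λ : Op d → Op d'} (hΛ : IsCLOCC d d' Λ)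
      (U : ∀ r, Matrix.unitaryGroup (Fin (d' r)) ℂ) :
      IsCLOCC d d' (fun ρ => localUnitary U (Λ ρ))
  | send {d' d'' : P → ℕ} {Λ : Op d → Op d'} (hΛ : IsCLOCC d d' Λ) (T : Transfer d' d'') :
      IsCLOCC d d'' (fun ρ => T.send (Λ ρ))

/-- Localisable information: the supremum of the total local information over all CLOCC
operations. For a state this is a supremum of a nonempty set that is bounded above by the `log₂`
of the total dimension. -/
noncomputable def localisableInformation {P : Type*} [Fintype P] [DecidableEq P] {d : P → ℕ}
    (ρ : Op d) : ℝ :=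
  sSup {t : ℝ | ∃ (d' : P → ℕ) (Λ : Op d → Op d'), IsCLOCC d d' Λ ∧ t = localInformation (Λ ρ)}

/-- The quantum information deficit `Δ(ρ) = I(ρ) - I_l(ρ)`. -/
noncomputable def deficit {P : Type*} [Fintype P] [DecidableEq P] {d : P → ℕ} (ρ : Op d) : ℝ :=
  information ρ - localisableInformation ρ

end QuantumDeficit

/-! Pull the final local measurements back through the protocol. Every CLOCC map has a
Hilbert-Schmidt adjoint that is linear, unital and preserves separability
(`IsCLOCC.exists_adjoint`). The product eigenprojectors of the final reduced states therefore become
separable density matrices `E x` on the original space with `∑ x, E x = 1`. Measuring them on `ρ`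
gives a distribution `p` whose marginals are the local spectra.

Let `q` be the product of these marginals. The cross entropy of `p` relative to `q` is the sum of
the local entropies, and the total dimension is conserved, so the information lost is this cross
entropy minus the entropy of `ρ`. A Klein inequality with quadratic remainder
(`quarter_trace_sq_sub_le`) bounds that difference below, in natural logarithms, by a quarter of the
squared Hilbert-Schmidt distance from `ρ` to the separable state `∑ x, q x • E x`.

Separable states form a compact set, so for entangled `ρ` this distance is bounded away from zero
independently of the protocol, and the gap survives the supremum. -/

/-- In a finite-dimensional space the convex hull of a compact set is compact. -/
theorem IsCompact.convexHull_of_finiteDimensional {E : Type*} [AddCommGroup E] [Module ℝ E]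
    [FiniteDimensional ℝ E] [TopologicalSpace E] [ContinuousAdd E] [ContinuousSMul ℝ E]
    {s : Set E} (hs : IsCompact s) : IsCompact (convexHull ℝ s) := by
  rcases s.eq_empty_or_nonempty with rfl | ⟨x₀, hx₀⟩
  · simp
  let N := Module.finrank ℝ E + 1
  have key : convexHull ℝ s = (fun p : (Fin N → ℝ) × (Fin N → E) => ∑ i, p.1 i • p.2 i) ''
      (stdSimplex ℝ (Fin N) ×ˢ Set.univ.pi fun _ => s) := by
    apply Set.Subset.antisymm
    · intro x hx
      -- Carathéodory: affine independence limits the number of points to dimension plus one. Zero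
      -- weights at the dummy point `x₀` then pad every combination to exactly `N` terms.
      obtain ⟨ι, _, z, w, hz, hind, hw, hw1, rfl⟩ := eq_pos_convex_span_of_mem_convexHull hx
      have hcard : Fintype.card ι ≤ Fintype.card (Fin N) := by
        rw [Fintype.card_fin]
        exact hind.card_le_finrank_succ.trans
          (Nat.succ_le_succ (Submodule.finrank_le _))
      obtain ⟨e⟩ := Function.Embedding.nonempty_of_card_le hcard
      refine ⟨(Function.extend e w 0, Function.extend e z fun _ => x₀), ⟨⟨?_, ?_⟩, ?_⟩, ?_⟩
      · intro j
        by_cases hj : ∃ i, e i = j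
        · obtain ⟨i, rfl⟩ := hj
          simpa [e.injective.extend_apply] using (hw i).le
        · simp [Function.extend_apply' _ _ _ hj]
      · rw [← hw1]
        refine (Fintype.sum_of_injective e e.injective w _ ?_ ?_).symm
        · intro j hj
          exact Function.extend_apply' _ _ _ hj
        · intro i
          exact (e.injective.extend_apply _ _ _).symm
      · intro j _
        by_cases hj : ∃ i, e i = j
        · obtain ⟨i, rfl⟩ := hj
          simpa [e.injective.extend_apply] using hz ⟨i, rfl⟩
        · simpa [Function.extend_apply' _ _ _ hj] using hx₀
      · refine (Fintype.sum_of_injective e e.injective (fun i => w i • z i) _ ?_ ?_).symm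
        · intro j hj
          simp [Function.extend_apply' _ _ _ hj]
        · intro i
          simp [e.injective.extend_apply]
    · rintro _ ⟨⟨w, z⟩, ⟨⟨hw, hw1⟩, hz⟩, rfl⟩
      exact (convex_convexHull ℝ s).sum_mem (fun i _ => hw i) hw1
        fun i _ => subset_convexHull ℝ s (hz i trivial)
  rw [key]
  refine ((isCompact_stdSimplex ℝ (Fin N)).prod (isCompact_univ_pi fun _ => hs)).image ?_
  exact continuous_finsetSum _ fun i _ =>
    ((continuous_apply i).comp continuous_fst).smul ((continuous_apply i).comp continuous_snd)

/-! ### Klein's inequality with a quadratic remainder -/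

namespace QuantumDeficit

/-- Both sides are compared with `(√p - √q) ^ 2`: the left because `√p + √q ≤ 2`, the right by `log
t ≤ t - 1` at `t = √q / √p`. -/
theorem quarter_sq_sub_le {p q : ℝ} (hp : 0 ≤ p) (hp1 : p ≤ 1) (hq : 0 < q) (hq1 : q ≤ 1) :
    (p - q) ^ 2 / 4 ≤ p * Real.log p - p * Real.log q - p + q := by
  have hs : (p - q) ^ 2 / 4 ≤ (√p - √q) ^ 2 := by
    have h1 : p - q = (√p - √q) * (√p + √q) := by
      nlinarith [Real.sq_sqrt hp, Real.sq_sqrt hq.le]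
    have h2 : √p ≤ 1 := Real.sqrt_le_one.mpr hp1
    have h3 : √q ≤ 1 := Real.sqrt_le_one.mpr hq1
    have h4 : (√p + √q) ^ 2 ≤ 4 := by
      nlinarith [Real.sqrt_nonneg p, Real.sqrt_nonneg q]
    rw [h1, mul_pow]
    nlinarith [mul_le_mul_of_nonneg_left h4 (sq_nonneg (√p - √q))]
  refine hs.trans ?_
  rcases hp.eq_or_lt with rfl | hp0
  · simp [Real.sq_sqrt hq.le]
  · have h1 := Real.log_le_sub_one_of_pos (div_pos (Real.sqrt_pos.2 hq) (Real.sqrt_pos.2 hp0))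
    rw [Real.log_div (Real.sqrt_pos.2 hq).ne' (Real.sqrt_pos.2 hp0).ne', Real.log_sqrt hq.le,
      Real.log_sqrt hp] at h1
    have h2 : p * (√q / √p - 1) = √p * √q - p := by
      have : √p ≠ 0 := (Real.sqrt_pos.2 hp0).ne'
      field_simp
      linear_combination (-√q) * Real.sq_sqrt hp
    nlinarith [mul_le_mul_of_nonneg_left h1 hp, Real.sq_sqrt hp, Real.sq_sqrt hq.le]

/-- Averages of a doubly stochastic array. -/
theorem quarter_sum_sq_sub_le {I X : Type*} [Fintype I] [Fintype X] (w : I → X → ℝ)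
    (hw : ∀ i x, 0 ≤ w i x) (hI : ∀ x, ∑ i, w i x = 1) (hX : ∀ i, ∑ x, w i x = 1)
    (p : I → ℝ) (hp : ∀ i, 0 ≤ p i) (hp1 : ∑ i, p i = 1)
    (q : X → ℝ) (hq : ∀ x, 0 ≤ q x) (hq1 : ∑ x, q x = 1)
    (hpq : ∀ x, q x = 0 → ∑ i, w i x * p i = 0) :
    (∑ i, p i ^ 2 - 2 * ∑ x, q x * ∑ i, w i x * p i + ∑ x, q x ^ 2) / 4 ≤
      ∑ i, p i * Real.log (p i) - ∑ x, (∑ i, w i x * p i) * Real.log (q x) := by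
  have hpl : ∀ i, p i ≤ 1 := fun i => hp1 ▸ Finset.single_le_sum (fun j _ => hp j) (Finset.mem_univ i)
  have hql : ∀ x, q x ≤ 1 := fun x => hq1 ▸ Finset.single_le_sum (fun j _ => hq j) (Finset.mem_univ x)
  have key : ∀ i x, w i x * ((p i - q x) ^ 2 / 4) ≤
      w i x * (p i * Real.log (p i) - p i * Real.log (q x) - p i + q x) := by
    intro i x
    -- At `q x = 0` the convention `log 0 = 0` would break the scalar inequality; `hpq` makes every
    -- such term vanish.
    rcases (hq x).eq_or_lt with h0 | h0
    · have h1 : w i x * p i = 0 :=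
        (Finset.sum_eq_zero_iff_of_nonneg fun i _ => mul_nonneg (hw i x) (hp i)).1
          (hpq x h0.symm) i (Finset.mem_univ i)
      rw [← h0]
      apply le_of_eq
      linear_combination (p i / 4 - Real.log (p i) + Real.log 0 + 1) * h1
    · exact mul_le_mul_of_nonneg_left (quarter_sq_sub_le (hp i) (hpl i) h0 (hql x)) (hw i x)
  have row : ∀ f : I → ℝ, ∑ i, ∑ x, w i x * f i = ∑ i, f i := fun f => by
    simp [← Finset.sum_mul, hX]
  have col : ∀ f : X → ℝ, ∑ i, ∑ x, w i x * f x = ∑ x, f x := fun f => by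
    rw [Finset.sum_comm]; simp [← Finset.sum_mul, hI]
  have mix : ∀ f : X → ℝ, ∑ i, ∑ x, w i x * (p i * f x) = ∑ x, (∑ i, w i x * p i) * f x :=
    fun f => by
      rw [Finset.sum_comm]; simp [Finset.sum_mul, mul_assoc]
  have h := Finset.sum_le_sum fun i (_ : i ∈ Finset.univ) =>
    Finset.sum_le_sum fun x (_ : x ∈ Finset.univ) => key i x
  have hl : ∑ i, ∑ x, w i x * ((p i - q x) ^ 2 / 4) =
      (∑ i, p i ^ 2 - 2 * ∑ x, q x * ∑ i, w i x * p i + ∑ x, q x ^ 2) / 4 := by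
    rw [← row fun i => p i ^ 2, ← col fun x => q x ^ 2]
    simp_rw [mul_comm (q _)]
    rw [← mix]
    simp only [Finset.mul_sum, ← Finset.sum_sub_distrib, ← Finset.sum_add_distrib, Finset.sum_div]
    refine Finset.sum_congr rfl fun i _ => Finset.sum_congr rfl fun x _ => by ring
  have hr : ∑ i, ∑ x, w i x * (p i * Real.log (p i) - p i * Real.log (q x) - p i + q x) =
      ∑ i, p i * Real.log (p i) - ∑ x, (∑ i, w i x * p i) * Real.log (q x) := by
    simp only [mul_add, mul_sub, Finset.sum_add_distrib, Finset.sum_sub_distrib]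
    rw [row fun i => p i * Real.log (p i), mix, row p, col q, hp1, hq1]
    ring
  rwa [hl, hr] at h

open scoped MatrixOrder in
theorem _root_.Matrix.PosSemidef.exists_eq_conjTranspose_mul_self {n : Type*} [Fintype n]
    {A : Matrix n n ℂ} (hA : A.PosSemidef) : ∃ B : Matrix n n ℂ, A = Bᴴ * B := by
  classical
  exact CStarAlgebra.nonneg_iff_eq_star_mul_self.mp hA.nonneg

theorem _root_.Matrix.PosSemidef.trace_mul_nonneg {n : Type*} [Fintype n]
    {A B : Matrix n n ℂ} (hA : A.PosSemidef) (hB : B.PosSemidef) : 0 ≤ (A * B).trace := by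
  obtain ⟨C, rfl⟩ := hA.exists_eq_conjTranspose_mul_self
  rw [Matrix.mul_assoc, Matrix.trace_mul_comm]
  exact (hB.mul_mul_conjTranspose_same C).trace_nonneg

/-- If a measurement `E` with trace-one effects has outcome distribution `p` on a density matrix
`ρ`, the cross entropy of `p` relative to `q` exceeds the entropy of `ρ` by at least a quarter of
the squared Hilbert-Schmidt distance of `ρ` from `∑ x, q x • E x`. -/
theorem quarter_trace_sq_sub_le {n X : Type*} [Fintype n] [DecidableEq n] [Fintype X]
    {ρ : Matrix n n ℂ} (hρ : IsDensity ρ) (E : X → Matrix n n ℂ) (hE : ∀ x, IsDensity (E x))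
    (hE1 : ∑ x, E x = 1) (q : X → ℝ) (hq : ∀ x, 0 ≤ q x) (hq1 : ∑ x, q x = 1)
    (hpq : ∀ x, q x = 0 → (ρ * E x).trace.re = 0) :
    ((ρ - ∑ x, q x • E x) * (ρ - ∑ x, q x • E x)).trace.re / 4 ≤
      ∑ i, hρ.1.1.eigenvalues i * Real.log (hρ.1.1.eigenvalues i) -
        ∑ x, (ρ * E x).trace.re * Real.log (q x) := by
  set p := hρ.1.1.eigenvalues
  let U : Matrix n n ℂ := (hρ.1.1.eigenvectorUnitary).1
  have hUU : U * Uᴴ = 1 := Matrix.mem_unitaryGroup_iff.1 (hρ.1.1.eigenvectorUnitary).2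
  have hUU' : Uᴴ * U = 1 := Matrix.mem_unitaryGroup_iff'.1 (hρ.1.1.eigenvectorUnitary).2
  have hspec : ρ = U * Matrix.diagonal (fun i => (p i : ℂ)) * Uᴴ := by
    have := hρ.1.1.spectral_theorem
    rw [Unitary.conjStarAlgAut_apply] at this
    exact this
  have htr : ∀ M : Matrix n n ℂ, (ρ * M).trace.re = ∑ i, ((Uᴴ * M * U) i i).re * p i := by
    intro M
    have h : (ρ * M).trace = (Matrix.diagonal (fun i => (p i : ℂ)) * (Uᴴ * M * U)).trace := by
      conv_lhs => rw [hspec]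
      rw [Matrix.mul_assoc, Matrix.mul_assoc, Matrix.trace_mul_comm U]
      simp only [Matrix.mul_assoc]
    rw [h]
    simp only [Matrix.trace, Matrix.diag, Matrix.diagonal_mul, Complex.re_sum,
      Complex.re_ofReal_mul]
    exact Finset.sum_congr rfl fun i _ => mul_comm _ _
  have hwn : ∀ x, (Uᴴ * E x * U).PosSemidef := fun x => (hE x).1.conjTranspose_mul_mul_same U
  have hp1 : ∑ i, p i = 1 := by
    have := hρ.2.symm.trans hρ.1.1.trace_eq_sum_eigenvalues
    apply Complex.ofReal_injective
    rw [Complex.ofReal_sum, Complex.ofReal_one]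
    exact this.symm
  -- The weights are the diagonal entries of `E x` in the eigenbasis of `ρ`. Trace one gives the
  -- sums over `i`, completeness the sums over `x`.
  have main := quarter_sum_sq_sub_le (fun i x => ((Uᴴ * E x * U) i i).re)
    (fun i x => (Complex.le_def.1 (hwn x).diag_nonneg).1) (fun x => by
      have h : (Uᴴ * E x * U).trace = 1 := by
        rw [Matrix.trace_mul_comm, ← Matrix.mul_assoc, hUU, Matrix.one_mul, (hE x).2]
      simpa [Matrix.trace] using congrArg Complex.re h) (fun i => by
      have h : ∑ x, Uᴴ * E x * U = 1 := by
        rw [← Finset.sum_mul, ← Finset.mul_sum, hE1, Matrix.mul_one, hUU']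
      have h2 := congrArg Complex.re (congrFun (congrFun h i) i)
      simpa [Matrix.sum_apply] using h2) p (fun i => hρ.1.eigenvalues_nonneg i) hp1 q hq hq1
      (fun x hx => by rw [← htr]; exact hpq x hx)
  simp only [← htr] at main
  refine le_trans ?_ main
  have hρ2 : (ρ * ρ).trace.re = ∑ i, p i ^ 2 := by
    have h : Uᴴ * ρ * U = Matrix.diagonal (fun i => (p i : ℂ)) := by
      conv_lhs => rw [hspec]
      simp only [← Matrix.mul_assoc, hUU', Matrix.one_mul]
      rw [Matrix.mul_assoc, hUU', Matrix.mul_one]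
    rw [htr, h]
    simp [sq]
  have hEE : (∑ x, q x • E x) * (∑ x, q x • E x) = ∑ x, ∑ y, (q x * q y) • (E x * E y) := by
    simp only [Finset.sum_mul, Finset.mul_sum, smul_mul_assoc, mul_smul_comm, Finset.smul_sum,
      smul_smul]
    rw [Finset.sum_comm]
    exact Finset.sum_congr rfl fun x _ => Finset.sum_congr rfl fun y _ => by rw [mul_comm (q y)]
  -- The effects need not be orthogonal projectors, so only an inequality holds. The overlaps `tr (E
  -- x * E y)` form a doubly stochastic array, and `2 * q x * q y ≤ q x ^ 2 + q y ^ 2` suffices.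
  have hσ : ((∑ x, q x • E x) * (∑ x, q x • E x)).trace.re ≤ ∑ x, q x ^ 2 := by
    have hc : ∀ x y, 0 ≤ (E x * E y).trace.re := fun x y =>
      (Complex.le_def.1 ((hE x).1.trace_mul_nonneg (hE y).1)).1
    have hr : ∀ x, ∑ y, (E x * E y).trace.re = 1 := fun x => by
      rw [← Complex.re_sum, ← Matrix.trace_sum, ← Finset.mul_sum, hE1, Matrix.mul_one, (hE x).2,
        Complex.one_re]
    have hl : ∀ y, ∑ x, (E x * E y).trace.re = 1 := fun y => by
      rw [← Complex.re_sum, ← Matrix.trace_sum, ← Finset.sum_mul, hE1, Matrix.one_mul, (hE y).2,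
        Complex.one_re]
    rw [hEE]
    simp only [Matrix.trace_sum, Complex.re_sum, Matrix.trace_smul, Complex.smul_re, smul_eq_mul]
    calc ∑ x, ∑ y, q x * q y * (E x * E y).trace.re
        ≤ ∑ x, ∑ y, (q x ^ 2 / 2 * (E x * E y).trace.re + q y ^ 2 / 2 * (E x * E y).trace.re) := by
          refine Finset.sum_le_sum fun x _ => Finset.sum_le_sum fun y _ => ?_
          nlinarith [mul_nonneg (hc x y) (sq_nonneg (q x - q y))]
      _ = ∑ x, q x ^ 2 := by
          simp only [Finset.sum_add_distrib]
          rw [Finset.sum_comm (f := fun x y => q y ^ 2 / 2 * (E x * E y).trace.re)]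
          simp only [← Finset.mul_sum, hr, hl, ← Finset.sum_add_distrib]
          exact Finset.sum_congr rfl fun x _ => by ring
  have hρσ : (ρ * ∑ x, q x • E x).trace.re = ∑ x, q x * (ρ * E x).trace.re := by
    simp [Finset.mul_sum, Matrix.trace_sum]
  have hexp : ((ρ - ∑ x, q x • E x) * (ρ - ∑ x, q x • E x)).trace.re =
      (ρ * ρ).trace.re - 2 * (ρ * ∑ x, q x • E x).trace.re +
        ((∑ x, q x • E x) * (∑ x, q x • E x)).trace.re := by
    rw [sub_mul, mul_sub, mul_sub, Matrix.trace_sub, Matrix.trace_sub, Matrix.trace_sub,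
      Matrix.trace_mul_comm (∑ x, q x • E x) ρ]
    simp only [Complex.sub_re]
    ring
  rw [hexp, hρσ, hρ2]
  linarith

theorem convex_isDensity {n : Type*} [Fintype n] : Convex ℝ {ρ : Matrix n n ℂ | IsDensity ρ} := by
  rintro ρ ⟨hρ, hρ1⟩ σ ⟨hσ, hσ1⟩ a b ha hb hab
  refine ⟨(hρ.smul ha).add (hσ.smul hb), ?_⟩
  rw [Matrix.trace_add, Matrix.trace_smul, Matrix.trace_smul, hρ1, hσ1, ← add_smul, hab, one_smul]

/-! ### Product operators -/

section tensor

variable {P : Type*} [Fintype P] {d : P → ℕ}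

theorem tensor_apply (M : ∀ r, Matrix (Fin (d r)) (Fin (d r)) ℂ) (x y : Idx d) :
    tensor M x y = ∏ r, M r (x r) (y r) := rfl

theorem tensor_conjTranspose (M : ∀ r, Matrix (Fin (d r)) (Fin (d r)) ℂ) :
    (tensor M)ᴴ = tensor fun r => (M r)ᴴ := by
  ext x y
  simp [tensor_apply]

theorem isSeparable_tensor {M : ∀ r, Matrix (Fin (d r)) (Fin (d r)) ℂ}
    (hM : ∀ r, IsDensity (M r)) : IsSeparable (tensor M) :=
  subset_convexHull ℝ _ ⟨M, hM, rfl⟩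

theorem tensor_one : tensor (fun r => (1 : Matrix (Fin (d r)) (Fin (d r)) ℂ)) = 1 := by
  ext x y
  rw [tensor_apply]
  by_cases h : x = y
  · subst h
    simp only [Matrix.one_apply_eq, Finset.prod_const_one]
  · obtain ⟨r, hr⟩ := Function.ne_iff.1 h
    rw [Matrix.one_apply_ne h]
    exact Finset.prod_eq_zero (Finset.mem_univ r) (Matrix.one_apply_ne hr)

variable [DecidableEq P]

theorem tensor_mul (M N : ∀ r, Matrix (Fin (d r)) (Fin (d r)) ℂ) :
    tensor M * tensor N = tensor fun r => M r * N r := by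
  ext x y
  simp only [Matrix.mul_apply, tensor_apply, ← Finset.prod_mul_distrib]
  exact (Fintype.prod_sum fun r a => M r (x r) a * N r a (y r)).symm

theorem trace_tensor (M : ∀ r, Matrix (Fin (d r)) (Fin (d r)) ℂ) :
    (tensor M).trace = ∏ r, (M r).trace :=
  (Fintype.prod_sum fun r a => M r a a).symm

theorem sum_tensor {κ : P → Type*} [∀ r, Fintype (κ r)]
    (M : ∀ r, κ r → Matrix (Fin (d r)) (Fin (d r)) ℂ) :
    ∑ x : ∀ r, κ r, tensor (fun r => M r (x r)) = tensor fun r => ∑ a, M r a := by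
  ext x y
  simp only [Matrix.sum_apply, tensor_apply]
  exact (Fintype.prod_sum fun r a => M r a (x r) (y r)).symm

theorem isDensity_tensor {M : ∀ r, Matrix (Fin (d r)) (Fin (d r)) ℂ} (hM : ∀ r, IsDensity (M r)) :
    IsDensity (tensor M) := by
  constructor
  · choose B hB using fun r => (hM r).1.exists_eq_conjTranspose_mul_self
    have : tensor M = (tensor B)ᴴ * tensor B := by
      rw [tensor_conjTranspose, tensor_mul]
      exact congrArg tensor (funext hB)
    rw [this]
    exact Matrix.posSemidef_conjTranspose_mul_self _
  · rw [trace_tensor]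
    exact Finset.prod_eq_one fun r _ => (hM r).2

theorem IsSeparable.isDensity {ρ : Op d} (hρ : IsSeparable ρ) : IsDensity ρ := by
  refine convexHull_min ?_ convex_isDensity hρ
  rintro _ ⟨M, hM, rfl⟩
  exact isDensity_tensor hM

end tensor

/-! ### Compactness of the separable states -/

theorem isCompact_isDensity {n : Type*} [Fintype n] :
    IsCompact {ρ : Matrix n n ℂ | IsDensity ρ} := by
  have hsub : {ρ : Matrix n n ℂ | IsDensity ρ} ⊆
      (Set.univ.pi fun _ : n => Set.univ.pi fun _ : n => Metric.closedBall (0 : ℂ) 1) := by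
    rintro ρ ⟨hρ, hρ1⟩ i - j -
    obtain ⟨B, rfl⟩ := hρ.exists_eq_conjTranspose_mul_self
    -- The trace is the squared Hilbert-Schmidt norm of `B`, so the columns of `B`, and hence the
    -- entries of `Bᴴ * B`, are bounded by one.
    have htot : ∑ j, ∑ k, ‖B k j‖ ^ 2 = 1 := by
      have h := congrArg Complex.re hρ1
      simp only [Matrix.trace, Matrix.diag, Matrix.mul_apply, Matrix.conjTranspose_apply,
        Complex.re_sum, Complex.one_re] at h
      rw [← h]
      refine Finset.sum_congr rfl fun j _ => Finset.sum_congr rfl fun k _ => ?_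
      rw [Complex.star_def, ← Complex.normSq_eq_conj_mul_self, Complex.ofReal_re,
        Complex.normSq_eq_norm_sq]
    have hcol : ∀ j, ∑ k, ‖B k j‖ ^ 2 ≤ 1 := fun j => htot ▸ Finset.single_le_sum
      (f := fun j => ∑ k, ‖B k j‖ ^ 2) (fun j _ => Finset.sum_nonneg fun k _ => sq_nonneg _)
      (Finset.mem_univ j)
    rw [mem_closedBall_zero_iff, Matrix.mul_apply]
    calc ‖∑ k, Bᴴ i k * B k j‖ ≤ ∑ k, (‖B k i‖ ^ 2 / 2 + ‖B k j‖ ^ 2 / 2) := by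
          refine norm_sum_le_of_le _ fun k _ => ?_
          rw [norm_mul, Matrix.conjTranspose_apply, norm_star]
          nlinarith [sq_nonneg (‖B k i‖ - ‖B k j‖)]
      _ ≤ 1 := by
          rw [Finset.sum_add_distrib, ← Finset.sum_div, ← Finset.sum_div]
          linarith [hcol i, hcol j]
  refine IsCompact.of_isClosed_subset
    (isCompact_univ_pi fun _ => isCompact_univ_pi fun _ => isCompact_closedBall _ _) ?_ hsub
  have hset : {ρ : Matrix n n ℂ | IsDensity ρ} =
      ({ρ | ρᴴ = ρ} ∩ ⋂ v : n → ℂ, {ρ | 0 ≤ star v ⬝ᵥ ρ *ᵥ v}) ∩ {ρ | ρ.trace = 1} := by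
    ext ρ
    simp [IsDensity, Matrix.posSemidef_iff_dotProduct_mulVec, Matrix.IsHermitian]
  rw [hset]
  refine (IsClosed.inter (isClosed_eq (by fun_prop) (by fun_prop))
    (isClosed_iInter fun v => ?_)).inter (isClosed_eq (by fun_prop) (by fun_prop))
  exact isClosed_le continuous_const (by fun_prop)

theorem isCompact_isSeparable {P : Type*} [Fintype P] {d : P → ℕ} :
    IsCompact {σ : Op d | IsSeparable σ} := by
  have h : {τ : Op d | ∃ M : ∀ r, Matrix (Fin (d r)) (Fin (d r)) ℂ,
      (∀ r, IsDensity (M r)) ∧ τ = tensor M} =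
      tensor '' Set.univ.pi fun r => {M : Matrix (Fin (d r)) (Fin (d r)) ℂ | IsDensity M} := by
    ext τ
    simp [Set.mem_image, eq_comm]
  have hc : IsCompact {τ : Op d | ∃ M : ∀ r, Matrix (Fin (d r)) (Fin (d r)) ℂ,
      (∀ r, IsDensity (M r)) ∧ τ = tensor M} := by
    rw [h]
    refine (isCompact_univ_pi fun r => isCompact_isDensity).image ?_
    refine continuous_matrix fun x y => ?_
    simp only [tensor_apply]
    fun_prop
  exact hc.convexHull_of_finiteDimensional

end QuantumDeficit

/-! ### Adjoints of CLOCC operations -/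

namespace QuantumDeficit

variable {P : Type*} {d d' : P → ℕ}

/-- Each term has the product of its traces as convex weight. A term of weight zero has a positive
factor of trace zero, hence vanishes, and is discarded before normalising. -/
theorem isSeparable_sum_tensor [Fintype P] {κ : Type*} [Fintype κ]
    (N : κ → ∀ r, Matrix (Fin (d r)) (Fin (d r)) ℂ) (hN : ∀ k r, (N k r).PosSemidef)
    (h1 : ∑ k, ∏ r, (N k r).trace = 1) : IsSeparable (∑ k, tensor (N k)) := by
  have htr : ∀ k r, (N k r).trace = ((N k r).trace.re : ℂ) := fun k r =>
    Complex.eq_re_of_ofReal_le (hN k r).trace_nonneg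
  have hnn : ∀ k r, 0 ≤ (N k r).trace.re := fun k r =>
    (Complex.le_def.1 (hN k r).trace_nonneg).1
  set w : κ → ℝ := fun k => ∏ r, (N k r).trace.re with hw
  have hw1 : ∑ k, w k = 1 := by
    apply Complex.ofReal_injective
    rw [Complex.ofReal_sum, Complex.ofReal_one, ← h1]
    exact Finset.sum_congr rfl fun k _ => by
      rw [hw, Complex.ofReal_prod]
      exact Finset.prod_congr rfl fun r _ => (htr k r).symm
  have hzero : ∀ k, w k = 0 → tensor (N k) = 0 := by
    intro k hk
    obtain ⟨r, -, hr⟩ := Finset.prod_eq_zero_iff.1 hk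
    have h0 : N k r = 0 := (hN k r).trace_eq_zero_iff.1 (by rw [htr, hr, Complex.ofReal_zero])
    ext x y
    exact Finset.prod_eq_zero (Finset.mem_univ r) (by rw [h0]; rfl)
  have hsmul : ∀ k, w k ≠ 0 →
      tensor (N k) = w k • tensor fun r => ((N k r).trace.re)⁻¹ • N k r := by
    intro k hk
    ext x y
    have hk' : ((w k : ℝ) : ℂ) ≠ 0 := Complex.ofReal_ne_zero.2 hk
    rw [Matrix.smul_apply, tensor_apply, tensor_apply]
    simp only [Matrix.smul_apply, Complex.real_smul, Complex.ofReal_inv, Finset.prod_mul_distrib,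
      Finset.prod_inv_distrib, ← Complex.ofReal_prod]
    exact (mul_inv_cancel_left₀ hk' _).symm
  have hsum : ∑ k, tensor (N k) = ∑ k ∈ Finset.univ.filter fun k => w k ≠ 0,
      w k • tensor fun r => ((N k r).trace.re)⁻¹ • N k r := by
    rw [Finset.sum_filter]
    refine Finset.sum_congr rfl fun k _ => ?_
    split_ifs with h
    · exact hsmul k h
    · exact hzero k (not_not.1 h)
  rw [hsum]
  refine (convex_convexHull ℝ _).sum_mem (fun k _ => Finset.prod_nonneg fun r _ => hnn k r) ?_ ?_
  · rw [Finset.sum_filter_ne_zero, hw1]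
  · intro k hk
    refine isSeparable_tensor fun r => ⟨(hN k r).smul (inv_nonneg.2 (hnn k r)), ?_⟩
    have hr : (N k r).trace.re ≠ 0 :=
      Finset.prod_ne_zero_iff.1 (Finset.mem_filter.1 hk).2 r (Finset.mem_univ r)
    rw [Matrix.trace_smul, htr, Complex.ofReal_re, Complex.real_smul, ← Complex.ofReal_mul,
      inv_mul_cancel₀ hr, Complex.ofReal_one]

theorem IsSeparable.map [Fintype P] (A : Op d' →ₗ[ℝ] Op d)
    (hA : ∀ M : ∀ r, Matrix (Fin (d' r)) (Fin (d' r)) ℂ, (∀ r, IsDensity (M r)) →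
      IsSeparable (A (tensor M))) {σ : Op d'} (hσ : IsSeparable σ) : IsSeparable (A σ) := by
  refine convexHull_min (t := A ⁻¹' {σ | IsSeparable σ}) ?_
    ((convex_convexHull ℝ _).linear_preimage A) hσ
  rintro _ ⟨M, hM, rfl⟩
  exact hA M hM

/-- The Hilbert-Schmidt adjoint of conjugation by a fixed matrix. -/
def conjugate {n : Type*} [Fintype n] (V : Matrix n n ℂ) : Matrix n n ℂ →ₗ[ℝ] Matrix n n ℂ where
  toFun M := Vᴴ * M * V
  map_add' M N := by rw [Matrix.mul_add, Matrix.add_mul]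
  map_smul' c M := by rw [Matrix.mul_smul, Matrix.smul_mul]; rfl

theorem IsDensity.conjTranspose_mul_mul {n : Type*} [Fintype n] [DecidableEq n] {M : Matrix n n ℂ}
    (hM : IsDensity M) (U : Matrix.unitaryGroup n ℂ) :
    IsDensity ((U : Matrix n n ℂ)ᴴ * M * (U : Matrix n n ℂ)) := by
  refine ⟨hM.1.conjTranspose_mul_mul_same _, ?_⟩
  have h : (U : Matrix n n ℂ) * (U : Matrix n n ℂ)ᴴ = 1 := Matrix.mem_unitaryGroup_iff.1 U.2
  rw [Matrix.trace_mul_comm, ← Matrix.mul_assoc, h, Matrix.one_mul, hM.2]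

/-- The Hilbert-Schmidt adjoint of `T.send`. -/
def Transfer.sendAdjoint (T : Transfer d d') : Op d' →ₗ[ℝ] Op d where
  toFun M := Matrix.of fun x y =>
    if (T.split (x T.sender)).2 = (T.split (y T.sender)).2 then M (T.relabel x) (T.relabel y) else 0
  map_add' M N := by
    ext x y
    simp only [Matrix.of_apply, Matrix.add_apply]
    split_ifs <;> simp
  map_smul' c M := by
    ext x y
    simp only [Matrix.of_apply, Matrix.smul_apply, RingHom.id_apply]
    split_ifs <;> simp

theorem Transfer.sendAdjoint_apply (T : Transfer d d') (M : Op d') (x y : Idx d) :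
    T.sendAdjoint M x y = if (T.split (x T.sender)).2 = (T.split (y T.sender)).2 then
      M (T.relabel x) (T.relabel y) else 0 := rfl

theorem Transfer.trace_send_mul [Fintype P] [DecidableEq P] (T : Transfer d d') (ρ : Op d) (M : Op d') :
    (T.send ρ * M).trace = (ρ * T.sendAdjoint M).trace := by
  simp only [Matrix.trace, Matrix.diag, Matrix.mul_apply]
  rw [← T.relabel.sum_comp]
  refine Finset.sum_congr rfl fun x _ => ?_
  rw [← T.relabel.sum_comp]
  refine Finset.sum_congr rfl fun y _ => ?_
  simp only [Transfer.send, Matrix.of_apply, Equiv.symm_apply_apply, T.sendAdjoint_apply]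
  by_cases h : (T.split (x T.sender)).2 = (T.split (y T.sender)).2
  · rw [if_pos h, if_pos h.symm]
  · rw [if_neg h, if_neg (Ne.symm h), zero_mul, mul_zero]

theorem Transfer.sendAdjoint_one [Fintype P] (T : Transfer d d') : T.sendAdjoint 1 = 1 := by
  ext x y
  rw [T.sendAdjoint_apply, Matrix.one_apply, Matrix.one_apply]
  by_cases h : x = y
  · subst h
    rw [if_pos rfl, if_pos rfl, if_pos rfl]
  · rw [if_neg (fun e => h (T.relabel.injective e)), if_neg h, ite_self]

/-- The local operators into which the adjoint of a transfer decomposes a product operator, given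
the basis state `k` of the sent subsystem. -/
def Transfer.component [DecidableEq P] (T : Transfer d d') (M : ∀ r, Matrix (Fin (d' r)) (Fin (d' r)) ℂ)
    (k : Fin T.b) : ∀ r, Matrix (Fin (d r)) (Fin (d r)) ℂ :=
  Function.update (Function.update
    (fun r => if h : r ≠ T.sender ∧ r ≠ T.receiver then
      (M r).submatrix (T.keep r h.1 h.2) (T.keep r h.1 h.2) else 0)
    T.receiver ((M T.receiver).submatrix (fun a => T.join (a, k)) fun a => T.join (a, k)))
    T.sender (Matrix.of fun a b => if (T.split a).2 = k ∧ (T.split b).2 = k then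
      M T.sender (T.split a).1 (T.split b).1 else 0)

theorem Transfer.component_sender [DecidableEq P] (T : Transfer d d')
    (M : ∀ r, Matrix (Fin (d' r)) (Fin (d' r)) ℂ) (k : Fin T.b) :
    T.component M k T.sender = Matrix.of fun a b => if (T.split a).2 = k ∧ (T.split b).2 = k then
      M T.sender (T.split a).1 (T.split b).1 else 0 :=
  Function.update_self ..

theorem Transfer.component_receiver [DecidableEq P] (T : Transfer d d')
    (M : ∀ r, Matrix (Fin (d' r)) (Fin (d' r)) ℂ) (k : Fin T.b) :
    T.component M k T.receiver =
      (M T.receiver).submatrix (fun a => T.join (a, k)) fun a => T.join (a, k) := by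
  rw [Transfer.component, Function.update_of_ne T.ne.symm, Function.update_self]

theorem Transfer.component_other [DecidableEq P] (T : Transfer d d')
    (M : ∀ r, Matrix (Fin (d' r)) (Fin (d' r)) ℂ) (k : Fin T.b) {r : P} (h₁ : r ≠ T.sender)
    (h₂ : r ≠ T.receiver) :
    T.component M k r = (M r).submatrix (T.keep r h₁ h₂) (T.keep r h₁ h₂) := by
  rw [Transfer.component, Function.update_of_ne h₁, Function.update_of_ne h₂, dif_pos ⟨h₁, h₂⟩]

theorem Transfer.posSemidef_component [DecidableEq P] (T : Transfer d d')
    {M : ∀ r, Matrix (Fin (d' r)) (Fin (d' r)) ℂ} (hM : ∀ r, (M r).PosSemidef) (k : Fin T.b)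
    (r : P) : (T.component M k r).PosSemidef := by
  by_cases h₁ : r = T.sender
  · subst h₁
    -- Reindexing by the first coordinate tensors `M T.sender` with the all-ones matrix; the
    -- diagonal projector then cuts out the block of `k`.
    have h : T.component M k T.sender =
        (Matrix.diagonal fun a => if (T.split a).2 = k then (1 : ℂ) else 0)ᴴ *
        (M T.sender).submatrix (fun a => (T.split a).1) (fun a => (T.split a).1) *
        Matrix.diagonal fun a => if (T.split a).2 = k then (1 : ℂ) else 0 := by
      rw [T.component_sender]
      ext a b
      rw [Matrix.diagonal_conjTranspose, Matrix.mul_diagonal, Matrix.diagonal_mul]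
      by_cases ha : (T.split a).2 = k <;> by_cases hb : (T.split b).2 = k <;> simp [ha, hb]
    rw [h]
    exact ((hM _).submatrix _).conjTranspose_mul_mul_same _
  · by_cases h₂ : r = T.receiver
    · subst h₂
      rw [T.component_receiver]
      exact (hM _).submatrix _
    · rw [T.component_other M k h₁ h₂]
      exact (hM _).submatrix _

/-- Only the receiver's factor has a trace depending on `k`: these factors are the diagonal blocks
of `M T.receiver`, whose traces add up to one. -/
theorem Transfer.sum_prod_trace_component [Fintype P] [DecidableEq P] (T : Transfer d d')
    {M : ∀ r, Matrix (Fin (d' r)) (Fin (d' r)) ℂ} (hM : ∀ r, (M r).trace = 1) :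
    ∑ k, ∏ r, (T.component M k r).trace = 1 := by
  have h : ∀ k, ∏ r, (T.component M k r).trace = (T.component M k T.receiver).trace := by
    intro k
    refine Fintype.prod_eq_single _ fun r h₂ => ?_
    by_cases h₁ : r = T.sender
    · subst h₁
      rw [T.component_sender, ← hM T.sender]
      simp only [Matrix.trace, Matrix.diag, Matrix.of_apply, and_self]
      rw [← T.split.symm.sum_comp, Fintype.sum_prod_type]
      simp
    · rw [T.component_other M k h₁ h₂, ← hM r]
      simp only [Matrix.trace, Matrix.diag, Matrix.submatrix_apply]
      exact (T.keep r h₁ h₂).sum_comp fun a => M r a a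
  simp only [h, T.component_receiver]
  rw [← hM T.receiver]
  simp only [Matrix.trace, Matrix.diag, Matrix.submatrix_apply]
  rw [← T.join.sum_comp, Fintype.sum_prod_type, Finset.sum_comm]

/-- This is where dephasing matters: erasing the entries between different states of the sent
subsystem leaves one product operator per basis state `k`. Without it, the receiver's operator could
correlate the two parties quantum mechanically. -/
theorem Transfer.sendAdjoint_tensor [Fintype P] [DecidableEq P] (T : Transfer d d')
    (M : ∀ r, Matrix (Fin (d' r)) (Fin (d' r)) ℂ) :
    T.sendAdjoint (tensor M) = ∑ k, tensor (T.component M k) := by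
  ext x y
  rw [T.sendAdjoint_apply, Matrix.sum_apply]
  simp only [tensor_apply]
  have hne : ∀ k, ¬ ((T.split (x T.sender)).2 = k ∧ (T.split (y T.sender)).2 = k) →
      ∏ r, T.component M k r (x r) (y r) = 0 := fun k hk =>
    Finset.prod_eq_zero (Finset.mem_univ T.sender) (by
      rw [T.component_sender, Matrix.of_apply, if_neg hk])
  split_ifs with h
  · rw [Fintype.sum_eq_single (T.split (x T.sender)).2
      fun k hk => hne k fun hk' => hk hk'.1.symm]
    refine Finset.prod_congr rfl fun r _ => ?_
    by_cases h₁ : r = T.sender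
    · subst h₁
      rw [T.component_sender, Matrix.of_apply, if_pos ⟨rfl, h.symm⟩, T.relabel_sender,
        T.relabel_sender]
    · by_cases h₂ : r = T.receiver
      · subst h₂
        rw [T.component_receiver, Matrix.submatrix_apply, T.relabel_receiver, T.relabel_receiver, h]
      · rw [T.component_other M _ h₁ h₂, Matrix.submatrix_apply, T.relabel_other x r h₁ h₂,
          T.relabel_other y r h₁ h₂]
  · exact (Finset.sum_eq_zero fun k _ => hne k fun hk => h (hk.1.trans hk.2.symm)).symm

/-- CLOCC operations have a unital linear Hilbert-Schmidt adjoint which preserves separability. -/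
theorem IsCLOCC.exists_adjoint [Fintype P] [DecidableEq P] {Λ : Op d → Op d'} (h : IsCLOCC d d' Λ) :
    ∃ A : Op d' →ₗ[ℝ] Op d, (∀ ρ M, (Λ ρ * M).trace = (ρ * A M).trace) ∧ A 1 = 1 ∧
      ∀ M, IsSeparable M → IsSeparable (A M) := by
  induction h with
  | id => exact ⟨LinearMap.id, fun _ _ => rfl, rfl, fun _ h => h⟩
  | unitary _ U ih =>
    obtain ⟨A, hA, hA1, hAS⟩ := ih
    refine ⟨A ∘ₗ conjugate (tensor fun r => (U r).1), fun ρ M => ?_, ?_, fun M hM => ?_⟩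
    · simp only [localUnitary]
      rw [LinearMap.comp_apply, ← hA, Matrix.mul_assoc, Matrix.mul_assoc, Matrix.trace_mul_comm]
      simp only [conjugate, LinearMap.coe_mk, AddHom.coe_mk, Matrix.mul_assoc]
    · have h1 : conjugate (tensor fun r => (U r).1) 1 = 1 := by
        simp only [conjugate, LinearMap.coe_mk, AddHom.coe_mk, Matrix.mul_one]
        rw [tensor_conjTranspose, tensor_mul, ← tensor_one]
        exact congrArg tensor (funext fun r => Matrix.mem_unitaryGroup_iff'.1 (U r).2)
      rw [LinearMap.comp_apply, h1, hA1]
    · refine hAS _ (hM.map _ fun N hN => ?_)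
      simp only [conjugate, LinearMap.coe_mk, AddHom.coe_mk]
      rw [tensor_conjTranspose, tensor_mul, tensor_mul]
      exact isSeparable_tensor fun r => (hN r).conjTranspose_mul_mul (U r)
  | send _ T ih =>
    obtain ⟨A, hA, hA1, hAS⟩ := ih
    refine ⟨A ∘ₗ T.sendAdjoint, fun ρ M => ?_, ?_, fun M hM => ?_⟩
    · rw [LinearMap.comp_apply, ← hA, T.trace_send_mul]
    · rw [LinearMap.comp_apply, T.sendAdjoint_one, hA1]
    · refine hAS _ (hM.map _ fun N hN => ?_)
      rw [T.sendAdjoint_tensor]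
      exact isSeparable_sum_tensor _ (T.posSemidef_component fun r => (hN r).1)
        (T.sum_prod_trace_component fun r => (hN r).2)

/-- Hermiticity of the output is enough to diagonalise its reduced states; nonnegativity of their
spectra comes later, from their being marginals of a probability distribution. -/
theorem IsCLOCC.isHermitian [Fintype P] [DecidableEq P] {Λ : Op d → Op d'} (h : IsCLOCC d d' Λ) {ρ : Op d}
    (hρ : ρ.IsHermitian) : (Λ ρ).IsHermitian := by
  induction h with
  | id => exact hρ
  | unitary _ U ih => exact Matrix.isHermitian_mul_mul_conjTranspose _ ih
  | send _ T ih =>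
    ext x y
    simp only [Transfer.send, Matrix.of_apply, Matrix.conjTranspose_apply]
    rw [eq_comm]
    split_ifs with h1 h2 h2
    · exact (ih.apply _ _).symm
    · exact absurd h1.symm h2
    · exact absurd h2.symm h1
    · exact (star_zero ℂ).symm

theorem IsCLOCC.card_eq [Fintype P] [DecidableEq P] {Λ : Op d → Op d'} (h : IsCLOCC d d' Λ) : ∏ r, d' r = ∏ r, d r := by
  have hc : Fintype.card (Idx d') = Fintype.card (Idx d) := by
    induction h with
    | id => rfl
    | unitary _ _ ih => exact ih
    | send _ T ih => exact (Fintype.card_congr T.relabel).symm.trans ih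
  simpa using hc

end QuantumDeficit

/-! ### Local spectra as marginals, and the bound for one protocol -/

namespace QuantumDeficit

variable {P : Type*} [Fintype P] [DecidableEq P] {d : P → ℕ}

/-- The partial trace is dual to padding with identities, which allows local eigenvalues to be read
off from a global product measurement. -/
theorem trace_reduced_mul (r : P) (τ : Op d) (B : Matrix (Fin (d r)) (Fin (d r)) ℂ) :
    (reduced r τ * B).trace = (τ * tensor (Function.update (fun _ => 1) r B)).trace := by
  have hT : ∀ x y : Idx d, tensor (Function.update (fun _ => 1) r B) y x =
      if ∀ s, s ≠ r → y s = x s then B (y r) (x r) else 0 := by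
    intro x y
    rw [tensor_apply]
    split_ifs with h
    · rw [Fintype.prod_eq_single r, Function.update_self]
      intro s hs
      rw [Function.update_of_ne hs, h s hs, Matrix.one_apply_eq]
    · push Not at h
      obtain ⟨s, hs, hne⟩ := h
      exact Finset.prod_eq_zero (Finset.mem_univ s) (by
        rw [Function.update_of_ne hs, Matrix.one_apply_ne hne])
  have hR : (τ * tensor (Function.update (fun _ => 1) r B)).trace =
      ∑ x, ∑ b, τ x (Function.update x r b) * B b (x r) := by
    simp only [Matrix.trace, Matrix.diag, Matrix.mul_apply, hT]
    refine Finset.sum_congr rfl fun x _ => ?_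
    refine (Fintype.sum_of_injective (fun b => Function.update x r b)
      (Function.update_injective x r) _ _ ?_ ?_).symm
    · intro y hy
      rw [if_neg, mul_zero]
      intro h
      refine hy ⟨y r, ?_⟩
      rw [Function.update_eq_iff]
      exact ⟨rfl, fun s hs => (h s hs).symm⟩
    · intro b
      simp only [Function.update_self]
      rw [if_pos fun s hs => Function.update_of_ne hs ..]
  rw [hR]
  simp only [Matrix.trace, Matrix.diag, Matrix.mul_apply, reduced, Matrix.of_apply, Finset.sum_mul,
    ite_mul, zero_mul]
  rw [Finset.sum_comm' (t' := Finset.univ) (s' := fun _ => Finset.univ) (by simp)]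
  rw [Finset.sum_congr rfl fun b _ => Finset.sum_comm, Finset.sum_comm]
  exact Finset.sum_congr rfl fun x _ => Finset.sum_congr rfl fun b _ => by simp

theorem reduced_isHermitian (r : P) {τ : Op d} (hτ : τ.IsHermitian) :
    (reduced r τ).IsHermitian := by
  ext a b
  simp only [reduced, Matrix.conjTranspose_apply, Matrix.of_apply, ← Finset.sum_filter, star_sum]
  refine Finset.sum_nbij' (fun x => Function.update x r a) (fun x => Function.update x r b)
    (by simp) (by simp) ?_ ?_ ?_
  · intro x hx
    simp [← (Finset.mem_filter.1 hx).2]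
  · intro x hx
    simp [← (Finset.mem_filter.1 hx).2]
  · intro x hx
    simp only [← (Finset.mem_filter.1 hx).2, Function.update_idem, Function.update_eq_self]
    exact hτ.apply _ _

section measurement

variable (R : ∀ r, Fin (d r) → Matrix (Fin (d r)) (Fin (d r)) ℂ)

theorem sum_ite_tensor (hR : ∀ r, ∑ a, R r a = 1) (r : P) (a : Fin (d r)) :
    ∑ x : Idx d, (if x r = a then tensor (fun s => R s (x s)) else 0) =
      tensor (Function.update (fun _ => 1) r (R r a)) := by
  -- Zeroing the factors of party `r` at outcomes other than `a` turns the constrained sum into a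
  -- full product sum.
  have h := sum_tensor (d := d) (κ := fun s => Fin (d s))
    (Function.update R r fun c => if c = a then R r a else 0)
  convert h using 1
  · refine Finset.sum_congr rfl fun x _ => ?_
    split_ifs with hx
    · congr 1
      funext s
      by_cases hs : s = r
      · subst hs
        rw [Function.update_self, if_pos hx, hx]
      · rw [Function.update_of_ne hs]
    · ext u v
      refine (Finset.prod_eq_zero (Finset.mem_univ r) ?_).symm
      beta_reduce
      rw [Function.update_self, if_neg hx]
      rfl
  · congr 1
    funext s
    by_cases hs : s = r
    · subst hs
      simp
    · simp [Function.update_of_ne hs, hR]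

end measurement

/-- The total entropy of marginals of a classical distribution, as a cross entropy. -/
theorem sum_mul_log_prod {κ : P → Type*} [∀ r, Fintype (κ r)] [∀ r, DecidableEq (κ r)]
    (p : (∀ r, κ r) → ℝ) (l : ∀ r, κ r → ℝ)
    (hl : ∀ r a, ∑ x, (if x r = a then p x else 0) = l r a)
    (h0 : ∀ x r, l r (x r) = 0 → p x = 0) :
    ∑ x, p x * Real.log (∏ r, l r (x r)) = ∑ r, ∑ a, l r a * Real.log (l r a) := by
  have h : ∀ x, p x * Real.log (∏ r, l r (x r)) = ∑ r, p x * Real.log (l r (x r)) := by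
    intro x
    -- The logarithm of the product splits only if no factor is zero, which `h0` ensures wherever `p
    -- x ≠ 0`.
    by_cases hx : p x = 0
    · simp [hx]
    · rw [Real.log_prod fun r _ hr => hx (h0 x r hr), Finset.mul_sum]
  simp only [h]
  rw [Finset.sum_comm]
  refine Finset.sum_congr rfl fun r _ => ?_
  simp only [← hl, Finset.sum_mul]
  rw [Finset.sum_comm]
  refine Finset.sum_congr rfl fun x _ => ?_
  simp [ite_mul]

theorem entropy_eq {X : Type*} [Fintype X] [DecidableEq X] {ρ : Matrix X X ℂ}
    (h : ρ.IsHermitian) :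
    Real.log 2 * entropy ρ = - ∑ i, h.eigenvalues i * Real.log (h.eigenvalues i) := by
  have h2 : Real.log 2 ≠ 0 := (Real.log_pos one_lt_two).ne'
  rw [entropy, dif_pos h, mul_neg, Finset.mul_sum]
  congr 1
  refine Finset.sum_congr rfl fun i _ => ?_
  rw [Real.logb]
  field_simp

/-- The deficit of a single CLOCC operation bounds the squared Hilbert-Schmidt distance from the
separable states. -/
theorem exists_isSeparable_trace_sq_le {d' : P → ℕ} {Λ : Op d → Op d'} (hΛ : IsCLOCC d d' Λ)
    {ρ : Op d} (hρ : IsDensity ρ) :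
    ∃ σ : Op d, IsSeparable σ ∧ ((ρ - σ) * (ρ - σ)).trace.re / 4 ≤
      Real.log 2 * (information ρ - localInformation (Λ ρ)) := by
  obtain ⟨A, hA, hA1, hAS⟩ := hΛ.exists_adjoint
  set τ := Λ ρ
  have hτ : ∀ r, (reduced r τ).IsHermitian := fun r =>
    reduced_isHermitian r (hΛ.isHermitian hρ.1.1)
  let V : ∀ r, Matrix.unitaryGroup (Fin (d' r)) ℂ := fun r => (hτ r).eigenvectorUnitary
  let l : ∀ r, Fin (d' r) → ℝ := fun r => (hτ r).eigenvalues
  have hVV : ∀ r, (V r).1 * (V r).1ᴴ = 1 := fun r => Matrix.mem_unitaryGroup_iff.1 (V r).2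
  have hVV' : ∀ r, (V r).1ᴴ * (V r).1 = 1 := fun r => Matrix.mem_unitaryGroup_iff'.1 (V r).2
  have hspec : ∀ r, reduced r τ =
      (V r).1 * Matrix.diagonal (fun i => (l r i : ℂ)) * (V r).1ᴴ := by
    intro r
    have := (hτ r).spectral_theorem
    rw [Unitary.conjStarAlgAut_apply] at this
    exact this
  let R : ∀ r, Fin (d' r) → Matrix (Fin (d' r)) (Fin (d' r)) ℂ := fun r a =>
    (V r).1 * Matrix.single a a 1 * (V r).1ᴴ
  have hR1 : ∀ r, ∑ a, R r a = 1 := by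
    intro r
    rw [← Finset.sum_mul, ← Finset.mul_sum, Matrix.sum_single_one, Matrix.mul_one, hVV]
  have hRD : ∀ r a, IsDensity (R r a) := by
    intro r a
    refine ⟨?_, ?_⟩
    · have h : R r a = ((V r).1 * Matrix.single a a 1) * ((V r).1 * Matrix.single a a 1)ᴴ := by
        simp only [R, Matrix.conjTranspose_mul, Matrix.conjTranspose_single, star_one]
        rw [← Matrix.mul_assoc, Matrix.mul_assoc (V r).1 (Matrix.single a a 1) (Matrix.single a a 1),
          Matrix.single_mul_single_same, mul_one]
      rw [h]
      exact Matrix.posSemidef_self_mul_conjTranspose _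
    · rw [Matrix.trace_mul_comm, ← Matrix.mul_assoc, hVV', Matrix.one_mul,
        Matrix.trace_single_eq_same]
  have hRtr : ∀ r a, (reduced r τ * R r a).trace = l r a := by
    intro r a
    have h : (reduced r τ * R r a).trace =
        (Matrix.diagonal (fun i => (l r i : ℂ)) * Matrix.single a a 1).trace := by
      rw [hspec, Matrix.mul_assoc, Matrix.mul_assoc, Matrix.trace_mul_comm]
      simp only [R, Matrix.mul_assoc, hVV', Matrix.mul_one]
      rw [← Matrix.mul_assoc (V r).1ᴴ, hVV', Matrix.one_mul]
    rw [h, Matrix.trace_mul_single]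
    simp
  -- The local eigenprojectors `R`, tensored and pulled back to the original space; separability
  -- preservation makes each effect a separable state.
  let E : Idx d' → Op d := fun x => A (tensor fun r => R r (x r))
  have hES : ∀ x, IsSeparable (E x) := fun x => hAS _ (isSeparable_tensor fun r => hRD r (x r))
  have hED : ∀ x, IsDensity (E x) := fun x => (hES x).isDensity
  have hE1 : ∑ x, E x = 1 := by
    rw [← map_sum, sum_tensor, ← hA1, ← tensor_one]
    simp only [hR1]
  let p : Idx d' → ℝ := fun x => (ρ * E x).trace.re
  have hp : ∀ x, 0 ≤ p x := fun x => (Complex.le_def.1 (hρ.1.trace_mul_nonneg (hED x).1)).1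
  have hp1 : ∑ x, p x = 1 := by
    simp only [p]
    rw [← Complex.re_sum, ← Matrix.trace_sum, ← Finset.mul_sum, hE1, Matrix.mul_one, hρ.2,
      Complex.one_re]
  have hl : ∀ r a, ∑ x, (if x r = a then p x else 0) = l r a := by
    intro r a
    have h := congrArg (fun M => (τ * M).trace.re) (sum_ite_tensor R hR1 r a)
    simp only [← trace_reduced_mul, hRtr, Complex.ofReal_re, Finset.mul_sum, Matrix.trace_sum,
      Complex.re_sum] at h
    rw [← h]
    refine Finset.sum_congr rfl fun x _ => ?_
    split_ifs
    · simp only [p, E, ← hA]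
      rfl
    · simp
  have hl0 : ∀ r a, 0 ≤ l r a := fun r a => by
    rw [← hl]
    exact Finset.sum_nonneg fun x _ => by split_ifs <;> simp [hp]
  have hple : ∀ x r, p x ≤ l r (x r) := fun x r => by
    rw [← hl]
    refine le_trans (by simp) (Finset.single_le_sum
      (f := fun y => if y r = x r then p y else 0) (fun y _ => ?_) (Finset.mem_univ x))
    split_ifs <;> simp [hp]
  have hl1 : ∀ r, ∑ a, l r a = 1 := fun r => by
    simp only [← hl]
    rw [Finset.sum_comm, ← hp1]
    exact Finset.sum_congr rfl fun x _ => by simp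
  have hzero : ∀ x r, l r (x r) = 0 → p x = 0 := fun x r h => le_antisymm (h ▸ hple x r) (hp x)
  -- With the product of the marginals as reference, the cross entropy becomes the sum of the local
  -- entropies.
  let q : Idx d' → ℝ := fun x => ∏ r, l r (x r)
  have hq : ∀ x, 0 ≤ q x := fun x => Finset.prod_nonneg fun r _ => hl0 r _
  have hq1 : ∑ x, q x = 1 := by
    simp only [q]
    rw [← Fintype.prod_sum]
    exact Finset.prod_eq_one fun r _ => hl1 r
  refine ⟨∑ x, q x • E x, (convex_convexHull ℝ _).sum_mem (fun x _ => hq x) hq1 fun x _ => hES x,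
    (quarter_trace_sq_sub_le hρ E hED hE1 q hq hq1 fun x hx => ?_).trans_eq ?_⟩
  · obtain ⟨r, -, hr⟩ := Finset.prod_eq_zero_iff.1 hx
    exact hzero x r hr
  · have hcross := sum_mul_log_prod p l hl hzero
    have hcard : Real.logb 2 (Fintype.card (Idx d)) =
        ∑ r, Real.logb 2 (Fintype.card (Fin (d' r))) := by
      -- A zero dimension would leave no outcomes, contradicting `∑ x, p x = 1`.
      have hd : ∏ r, d' r ≠ 0 := by
        intro h0
        have : IsEmpty (Idx d') := by
          rw [← Fintype.card_eq_zero_iff]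
          simpa using h0
        simp at hp1
      rw [Fintype.card_pi]
      simp only [Fintype.card_fin]
      rw [← hΛ.card_eq, Nat.cast_prod, Real.logb_prod]
      intro r hr h0
      exact hd (Finset.prod_eq_zero hr (Nat.cast_eq_zero.1 h0))
    rw [hcross]
    simp only [information, localInformation, Finset.sum_sub_distrib, mul_sub, Finset.mul_sum]
    rw [hcard, Finset.mul_sum, entropy_eq hρ.1.1]
    simp only [entropy_eq (hτ _), Finset.sum_neg_distrib]
    ring

theorem trace_sub_mul_sub_pos {n : Type*} [Fintype n] {ρ σ : Matrix n n ℂ} (hρ : ρ.IsHermitian)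
    (hσ : σ.IsHermitian) (h : ρ ≠ σ) : 0 < ((ρ - σ) * (ρ - σ)).trace.re := by
  have hH : (ρ - σ)ᴴ = ρ - σ := hρ.sub hσ
  have h0 : 0 ≤ ((ρ - σ)ᴴ * (ρ - σ)).trace :=
    (Matrix.posSemidef_conjTranspose_mul_self _).trace_nonneg
  have hne : ((ρ - σ)ᴴ * (ρ - σ)).trace ≠ 0 := fun h' =>
    h (sub_eq_zero.1 (Matrix.trace_conjTranspose_mul_self_eq_zero_iff.1 h'))
  rw [hH] at h0 hne
  exact (Complex.lt_def.1 (lt_of_le_of_ne h0 hne.symm)).1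

end QuantumDeficit

/-! ### Uniform gap for entangled states -/

open QuantumDeficit in
theorem mainTheorem4 {P : Type*} [Fintype P] [DecidableEq P] (d : P → ℕ)
    (ρ : QuantumDeficit.Op d) (hρ : QuantumDeficit.IsEntangled ρ) :
    0 < QuantumDeficit.deficit ρ := by
  obtain ⟨hD, hS⟩ := hρ
  have hcont : Continuous fun σ : Op d => ((ρ - σ) * (ρ - σ)).trace.re := by fun_prop
  -- The separable state produced by the bound varies with the protocol and the supremum need not be
  -- attained, so one `ε` valid for all separable states is needed.
  obtain ⟨ε, hε, hmin⟩ := isCompact_isSeparable.exists_forall_le' (a := 0) hcont.continuousOn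
    fun σ hσ => trace_sub_mul_sub_pos hD.1.1 (IsSeparable.isDensity hσ).1.1
      fun h => hS (h ▸ hσ)
  have hlog : 0 < Real.log 2 := Real.log_pos one_lt_two
  have hle : localisableInformation ρ ≤ information ρ - ε / 4 / Real.log 2 := by
    refine csSup_le ⟨_, d, _, IsCLOCC.id, rfl⟩ ?_
    rintro _ ⟨d', Λ, hΛ, rfl⟩
    obtain ⟨σ, hσ, h⟩ := exists_isSeparable_trace_sq_le hΛ hD
    have h2 : ε / 4 / Real.log 2 ≤ information ρ - localInformation (Λ ρ) := by
      rw [div_le_iff₀ hlog, mul_comm]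
      linarith [hmin σ hσ]
    linarith
  have : 0 < ε / 4 / Real.log 2 := by positivity
  unfold deficit
  linarith
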